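/- Let $d, W, L\in\mathbb N$ with $1\le d\le W$ and $L\ge 1$, and let $b\ge 1$ and $B$ be real numbers with $((W+1)b)^L\le B$. Let $\mathcal F_{d,W,L,b}$ be the class of all functions $f:\mathbb R^d\to\mathbb R$ of the form $$f=h_L\circ \mathrm{ReLU}\circ h_{L-1}\circ\cdots\circ \mathrm{ReLU}\circ h_1,\qquad h_l(x)=W_lx+b_l,$$ with exactly $L$ affine layers of dimensions $d_0=d,d_1,\dots,d_{L-1},d_L=1$, where $\mathrm{ReLU}(x)=\max\{0,x\}$ acts coordinatewise, the width $\max\{d_0,\dots,d_L\}$ is at most $W$, and all entries of all $W_l$ and $b_l$ have absolute value at most $b$. For $\mathcal X\subseteq[0,1]^d$ and a class $\mathcal F$ of functions $\mathbb R^d\to\mathbb R$, let $N(\mathcal F,\|\cdot\|_\infty,\epsilon)$ be the $\epsilon$-covering number of $\mathcal F$ with respect to $\|f\|_\infty=\sup_{x\in\mathcal X}|f(x)|$, and let the effective dimension $dim=dim_{\mathcal X}(\mathcal F)$ be the infimum of all real $D\ge 0$ with $N(\mathcal F,\|\cdot\|_\infty,\epsilon)=O((1/\epsilon)^{D})$ as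 $\epsilon\to0$ (the implied constant may depend on $\mathcal X$, $\mathcal F$ and $D$). Then there are absolute constants $c,C>0$, independent of $d,W,L,b,B$ (and of $\mathcal X$, $\mathcal F$ below), such that the following hold. 1. For every $\mathcal X\subseteq[0,1]^d$ and every $\mathcal F\subseteq\mathcal F_{d,W,L,b}$: every $f\in\mathcal F$ maps $\mathcal X$ into $[-B,B]$; there is an exponent $D\le C\,W^2L$ with $N(\mathcal F,\|\cdot\|_\infty,\epsilon)=O((1/\epsilon)^{D})$ as $\epsilon\to 0$; and hence $dim_{\mathcal X}(\mathcal F)\le C\,W^2L$. 2. If moreover $W\ge 60$ and $L\ge 60$, then for $\mathcal X=[0,1]^d$ the full class satisfies $c\,W^2L\le dim_{[0,1]^d}(\mathcal F_{d,W,L,b})\le C\,W^2L$. -/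

import Mathlib

open scoped NNReal ENNReal

/-- Parameters `(W₁, b₁, …, W_L, b_L)` of a multilayer perceptron with exactly `L ≥ 1` affine
layers, input dimension `d` and output dimension `m`. A network is either one affine layer, or a
first affine layer followed (after a ReLU) by a network with one layer less. The dimensions
`d₀ = d, d₁, …, d_L = m` are part of the data and are otherwise arbitrary. -/
inductive MLP : ℕ → ℕ → ℕ → Type
  | last {d m : ℕ} (A : Matrix (Fin m) (Fin d) ℝ) (c : Fin m → ℝ) : MLP 1 d m
  | layer {L d k m : ℕ} (A : Matrix (Fin k) (Fin d) ℝ) (c : Fin k → ℝ) (N : MLP L k m) :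
      MLP (L + 1) d m

namespace MLP

/-- The ReLU activation, applied to every coordinate. -/
noncomputable def relu {n : ℕ} (v : Fin n → ℝ) : Fin n → ℝ := fun i => max 0 (v i)

/-- The function `h_L ∘ ReLU ∘ h_{L-1} ∘ ⋯ ∘ ReLU ∘ h₁` computed by the network, where
`h_l x = W_l x + b_l`. -/
noncomputable def eval : {L d m : ℕ} → MLP L d m → (Fin d → ℝ) → (Fin m → ℝ)
  | _, _, _, .last A c, x => A.mulVec x + c
  | _, _, _, .layer A c N, x => N.eval (relu (A.mulVec x + c))

/-- The width `max {d₀, …, d_L}` of the network. -/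
def width : {L d m : ℕ} → MLP L d m → ℕ
  | _, d, m, .last _ _ => max d m
  | _, d, _, .layer _ _ N => max d N.width

/-- All entries of all weight matrices and of all bias vectors have absolute value at most `b`. -/
def WeightsLE (b : ℝ) : {L d m : ℕ} → MLP L d m → Prop
  | _, _, _, .last A c => (∀ i j, |A i j| ≤ b) ∧ (∀ i, |c i| ≤ b)
  | _, _, _, .layer A c N => (∀ i j, |A i j| ≤ b) ∧ (∀ i, |c i| ≤ b) ∧ N.WeightsLE b

end MLP

/-- The class of all real-valued functions on `ℝ^d` that are computed by ReLU multilayer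
perceptrons with exactly `L` layers, width at most `W` and weights bounded by `b`. -/
def mlpClass (d W L : ℕ) (b : ℝ) : Set ((Fin d → ℝ) → ℝ) :=
  {f | ∃ N : MLP L d 1, N.width ≤ W ∧ N.WeightsLE b ∧ ∀ x, f x = N.eval x 0}

/-- The covering number `N(F, ‖·‖_∞, ε)` for the sup norm over `X`: the restrictions to `X` of the
functions in `F` are regarded as points of the space of functions `X → ℝ` with the
(extended) uniform distance `sup_{x ∈ X} |f x - g x|`. -/
noncomputable def supCoveringNumber {E : Type*} (X : Set E) (F : Set (E → ℝ)) (ε : ℝ≥0) : ℕ∞ :=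
  Metric.coveringNumber ε ((fun f : E → ℝ => UniformFun.ofFun (X.domRestrict f)) '' F)

/-- `N(F, ‖·‖_∞, ε) = O((1/ε)^D)` as `ε → 0`. Since the covering number is antitone in `ε`, the range
`0 < ε ≤ 1` could be replaced by any other range `0 < ε ≤ ε₀` on which it is finite. -/
def HasCoveringExponent {E : Type*} (X : Set E) (F : Set (E → ℝ)) (D : ℝ≥0) : Prop :=
  ∃ K : ℝ≥0, ∀ ε : ℝ≥0, 0 < ε → ε ≤ 1 →
    (supCoveringNumber X F ε : ℝ≥0∞) ≤ ((K * (1 / ε) ^ (D : ℝ) : ℝ≥0) : ℝ≥0∞)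

/-- The effective dimension of `F` on `X`: the infimum of all exponents `D ≥ 0` with
`N(F, ‖·‖_∞, ε) = O((1/ε)^D)` (and `∞` if there is no such exponent). -/
noncomputable def effectiveDim {E : Type*} (X : Set E) (F : Set (E → ℝ)) : ℝ≥0∞ :=
  ⨅ (D : ℝ≥0) (_ : HasCoveringExponent X F D), (D : ℝ≥0∞)

/-- The boundedness and covering assumption with exponent `D`: the features lie in the unit cube, all
functions of the class map the feature space into `[-B, B]`, and `N(F, ‖·‖_∞, ε) = O((1/ε)^D)`. -/
structure BoundedCovering {d : ℕ} (X : Set (Fin d → ℝ)) (F : Set ((Fin d → ℝ) → ℝ))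
    (B : ℝ) (D : ℝ≥0) : Prop where
  subset_cube : X ⊆ Set.Icc 0 1
  bounded : ∀ f ∈ F, ∀ x ∈ X, f x ∈ Set.Icc (-B) B
  covering : HasCoveringExponent X F D

/-!
Upper bound: on a bounded set of inputs an affine layer is a Lipschitz function of its at most
`W * (W + 1)` weights, so the layers form a class of covering exponent `W * (W + 1)`. Exponents add
up under composition of Lipschitz classes, which gives `L * W * (W + 1)` for `L` layers.

Lower bound: if the values of functions of the class at finitely many points depend on a parameter
ranging over a cube of dimension `p` through an injective linear map, then the class contains an
antilipschitz copy of the cube, and its effective dimension is at least `p`. Such a family with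
`p ≈ W ^ 2 * L` consists of `m ≈ L / 3` blocks of three hidden layers, whose outputs are added up.
In a block the first layer computes a sawtooth with `n ≈ W / 3` teeth, the second one applies `n`
thresholds to it, and the third one combines the resulting features with `n ^ 2` free weights, the
`k`-th combination being switched on to the right of the `k`-th tooth only. If the teeth of
different blocks do not overlap, then at `n` points under each tooth the values are an affine
function of all `m * n ^ 2` weights, and its linear part is the Kronecker product of an identity
matrix and two triangular matrices, for the gates and for the thresholds.
-/

/-- The set `F` of maps into a metric space has `ε`-nets of `O(ε⁻¹ ^ p)` points, contained in `F`,
for the uniform distance over `X`. Compared with `HasCoveringExponent` the values need not be real,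
so that composition makes sense. -/
def HasNetExponent {α β : Type*} [PseudoMetricSpace β] (X : Set α) (F : Set (α → β)) (p : ℕ) :
    Prop :=
  ∃ K : ℝ, 0 ≤ K ∧ ∀ ε : ℝ, 0 < ε → ε ≤ 1 → ∃ G : Finset (α → β), ↑G ⊆ F ∧
    (G.card : ℝ) ≤ K * ε⁻¹ ^ p ∧ ∀ f ∈ F, ∃ g ∈ G, ∀ x ∈ X, dist (f x) (g x) ≤ ε

namespace HasNetExponent

variable {α β γ : Type*} [PseudoMetricSpace β] [PseudoMetricSpace γ] {X : Set α}
  {F : Set (α → β)} {p q : ℕ}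

theorem of_dist_le_mul {C K : ℝ} (hC : 1 ≤ C) (hK : 0 ≤ K)
    (h : ∀ ε : ℝ, 0 < ε → ε ≤ 1 → ∃ G : Finset (α → β), ↑G ⊆ F ∧ (G.card : ℝ) ≤ K * ε⁻¹ ^ p ∧
      ∀ f ∈ F, ∃ g ∈ G, ∀ x ∈ X, dist (f x) (g x) ≤ C * ε) :
    HasNetExponent X F p := by
  refine ⟨K * C ^ p, by positivity, fun ε hε hε1 => ?_⟩
  have hεC : ε / C ≤ 1 := div_le_one_of_le₀ (by linarith) (by linarith)
  obtain ⟨G, hGF, hcard, hG⟩ := h (ε / C) (by positivity) hεC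
  refine ⟨G, hGF, hcard.trans_eq ?_, ?_⟩
  · rw [inv_div, div_eq_mul_inv, mul_pow, mul_assoc]
  · rwa [mul_div_cancel₀ _ (by positivity)] at hG

theorem mono {X' : Set α} (h : HasNetExponent X F p) (hX : X' ⊆ X) (hpq : p ≤ q) :
    HasNetExponent X' F q := by
  obtain ⟨K, hK, h⟩ := h
  refine ⟨K, hK, fun ε hε hε1 => ?_⟩
  obtain ⟨G, hGF, hcard, hG⟩ := h ε hε hε1
  have hpow : ε⁻¹ ^ p ≤ ε⁻¹ ^ q := pow_le_pow_right₀ ((one_le_inv₀ hε).2 hε1) hpq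
  refine ⟨G, hGF, hcard.trans (by gcongr), fun f hf => ?_⟩
  obtain ⟨g, hg, hfg⟩ := hG f hf
  exact ⟨g, hg, fun x hx => hfg x (hX hx)⟩

theorem singleton (X : Set α) (f : α → β) : HasNetExponent X {f} 0 :=
  ⟨1, zero_le_one, fun ε hε _ => ⟨{f}, by simp, by simp, by simpa using fun _ _ => hε.le⟩⟩

theorem iUnion {ι : Type*} [Finite ι] {F : ι → Set (α → β)} (h : ∀ i, HasNetExponent X (F i) p) :
    HasNetExponent X (⋃ i, F i) p := by
  classical
  have := Fintype.ofFinite ι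
  choose K hK h using h
  refine ⟨∑ i, K i, Finset.sum_nonneg fun i _ => hK i, fun ε hε hε1 => ?_⟩
  choose G hGF hcard hG using fun i => h i ε hε hε1
  refine ⟨Finset.univ.biUnion G, ?_, ?_, fun f hf => ?_⟩
  · simpa using fun i => (hGF i).trans (Set.subset_iUnion F i)
  · calc ((Finset.univ.biUnion G).card : ℝ) ≤ ∑ i, ((G i).card : ℝ) := by
          exact_mod_cast Finset.card_biUnion_le
      _ ≤ ∑ i, K i * ε⁻¹ ^ p := Finset.sum_le_sum fun i _ => hcard i
      _ = (∑ i, K i) * ε⁻¹ ^ p := (Finset.sum_mul ..).symm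
  · obtain ⟨i, hi⟩ := Set.mem_iUnion.1 hf
    obtain ⟨g, hg, hfg⟩ := hG i f hi
    exact ⟨g, Finset.mem_biUnion.2 ⟨i, Finset.mem_univ i, hg⟩, hfg⟩

theorem image2_comp {Y : Set β} {G : Set (β → γ)} {Λ : ℝ≥0} (hF : HasNetExponent X F p)
    (hG : HasNetExponent Y G q) (hXY : ∀ f ∈ F, Set.MapsTo f X Y)
    (hΛ : ∀ g ∈ G, LipschitzOnWith Λ g Y) :
    HasNetExponent X (Set.image2 (· ∘ ·) G F) (p + q) := by
  classical
  obtain ⟨K, hK, hF⟩ := hF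
  obtain ⟨K', hK', hG⟩ := hG
  refine of_dist_le_mul (C := 1 + Λ) (K := K' * K) (by simp) (by positivity) fun ε hε hε1 => ?_
  obtain ⟨S, hSF, hS, hSnet⟩ := hF ε hε hε1
  obtain ⟨T, hTG, hT, hTnet⟩ := hG ε hε hε1
  refine ⟨Finset.image₂ (· ∘ ·) T S, ?_, ?_, ?_⟩
  · rw [Finset.coe_image₂]
    exact Set.image2_subset hTG hSF
  · calc ((Finset.image₂ (· ∘ ·) T S).card : ℝ) ≤ T.card * S.card := by
          exact_mod_cast Finset.card_image₂_le (· ∘ ·) T S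
      _ ≤ (K' * ε⁻¹ ^ q) * (K * ε⁻¹ ^ p) := by gcongr
      _ = K' * K * ε⁻¹ ^ (p + q) := by ring
  · rintro _ ⟨g, hg, f, hf, rfl⟩
    obtain ⟨g', hg', hgg'⟩ := hTnet g hg
    obtain ⟨f', hf', hff'⟩ := hSnet f hf
    refine ⟨g' ∘ f', Finset.mem_image₂_of_mem hg' hf', fun x hx => ?_⟩
    have hfx : f x ∈ Y := hXY f hf hx
    calc dist (g (f x)) (g' (f' x))
        ≤ dist (g (f x)) (g' (f x)) + dist (g' (f x)) (g' (f' x)) := dist_triangle ..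
      _ ≤ ε + Λ * dist (f x) (f' x) :=
          add_le_add (hgg' _ hfx) ((hΛ g' (hTG hg')).dist_le_mul _ hfx _ (hXY f' (hSF hf') hx))
      _ ≤ (1 + Λ) * ε := by
          rw [add_mul, one_mul]
          gcongr
          exact hff' x hx

theorem image_lipschitz_comp {φ : β → γ} {Λ : ℝ≥0} (h : HasNetExponent X F p)
    (hφ : LipschitzWith Λ φ) : HasNetExponent X ((φ ∘ ·) '' F) p := by
  rw [← Set.image2_singleton_left (f := (· ∘ ·))]
  exact h.image2_comp (singleton Set.univ φ) (fun f _ => Set.mapsTo_univ f X)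
    (by simpa using hφ)

end HasNetExponent

theorem exists_finset_net_closedBall_real {b ε : ℝ} (hb : 0 ≤ b) (hε : 0 < ε) :
    ∃ G : Finset ℝ, (G : Set ℝ) ⊆ Metric.closedBall 0 b ∧ (G.card : ℝ) ≤ 2 * b / ε + 1 ∧
      ∀ x ∈ Metric.closedBall 0 b, ∃ y ∈ G, dist x y ≤ ε := by
  simp only [Real.closedBall_eq_Icc, zero_sub, zero_add]
  refine ⟨(Finset.range (⌊2 * b / ε⌋₊ + 1)).image fun j : ℕ => -b + j * ε, ?_, ?_, fun x hx => ?_⟩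
  · intro y hy
    obtain ⟨j, hj, rfl⟩ := Finset.mem_image.1 hy
    have hj' : j * ε ≤ 2 * b := by
      rw [← le_div_iff₀ hε]
      exact (Nat.cast_le.2 (Finset.mem_range_succ_iff.1 hj)).trans (Nat.floor_le (by positivity))
    constructor
    · linarith [show 0 ≤ j * ε by positivity]
    · linarith
  · calc _ ≤ ((⌊2 * b / ε⌋₊ + 1 : ℕ) : ℝ) := by
          exact_mod_cast Finset.card_image_le.trans_eq (Finset.card_range _)
      _ ≤ 2 * b / ε + 1 := by
          push_cast
          gcongr
          exact Nat.floor_le (by positivity)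
  · have hfloor := Nat.floor_le (div_nonneg (neg_le_iff_add_nonneg.1 hx.1) hε.le)
    have hlt := (Nat.lt_floor_add_one ((x + b) / ε)).le
    rw [le_div_iff₀ hε] at hfloor
    rw [div_le_iff₀ hε] at hlt
    refine ⟨-b + ⌊(x + b) / ε⌋₊ * ε, Finset.mem_image_of_mem _ ?_, ?_⟩
    · rw [Finset.mem_range_succ_iff]
      gcongr
      linarith [hx.2]
    · rw [Real.dist_eq, abs_le]
      constructor <;> linarith

theorem exists_finset_net_closedBall {ι : Type*} [Fintype ι] {b ε : ℝ} (hb : 0 ≤ b)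
    (hε : 0 < ε) (hε1 : ε ≤ 1) :
    ∃ G : Finset (ι → ℝ), (G : Set (ι → ℝ)) ⊆ Metric.closedBall 0 b ∧
      (G.card : ℝ) ≤ (2 * b + 1) ^ Fintype.card ι * ε⁻¹ ^ Fintype.card ι ∧
      ∀ v ∈ Metric.closedBall 0 b, ∃ w ∈ G, dist v w ≤ ε := by
  classical
  obtain ⟨G, hGb, hcard, hG⟩ := exists_finset_net_closedBall_real hb hε
  refine ⟨Fintype.piFinset fun _ => G, fun v hv => ?_, ?_, fun v hv => ?_⟩
  · rw [closedBall_pi _ hb]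
    exact fun i _ => hGb (Fintype.mem_piFinset.1 hv i)
  · rw [Fintype.card_piFinset, Finset.prod_const, Finset.card_univ, Nat.cast_pow, ← mul_pow]
    gcongr
    calc (G.card : ℝ) ≤ 2 * b / ε + 1 := hcard
      _ ≤ 2 * b * ε⁻¹ + ε⁻¹ := by
          rw [div_eq_mul_inv]
          gcongr
          exact (one_le_inv₀ hε).2 hε1
      _ = (2 * b + 1) * ε⁻¹ := by ring
  · rw [closedBall_pi _ hb] at hv
    choose w hw hvw using fun i => hG (v i) (hv i (Set.mem_univ i))
    exact ⟨w, Fintype.mem_piFinset.2 hw, (dist_pi_le_iff hε.le).2 hvw⟩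

theorem hasNetExponent_image_closedBall {ι α β : Type*} [Fintype ι] [PseudoMetricSpace β]
    {X : Set α} {P : (ι → ℝ) → α → β} {b : ℝ} {Λ : ℝ≥0} (hb : 0 ≤ b)
    (hP : ∀ x ∈ X, LipschitzOnWith Λ (fun v => P v x) (Metric.closedBall 0 b)) :
    HasNetExponent X (P '' Metric.closedBall 0 b) (Fintype.card ι) := by
  classical
  refine .of_dist_le_mul (C := 1 + Λ) (K := (2 * b + 1) ^ Fintype.card ι) (by simp) (by positivity)
    fun ε hε hε1 => ?_
  obtain ⟨G, hGb, hcard, hG⟩ := exists_finset_net_closedBall (ι := ι) hb hε hε1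
  refine ⟨G.image P, ?_, (Nat.cast_le.2 Finset.card_image_le).trans hcard, ?_⟩
  · rw [Finset.coe_image]
    exact Set.image_mono hGb
  · rintro _ ⟨v, hv, rfl⟩
    obtain ⟨w, hw, hvw⟩ := hG v hv
    refine ⟨P w, Finset.mem_image_of_mem P hw, fun x hx => ?_⟩
    calc dist (P v x) (P w x) ≤ Λ * dist v w := (hP x hx).dist_le_mul v hv w (hGb hw)
      _ ≤ (1 + Λ) * ε := by gcongr; simp

theorem HasCoveringExponent.subset {E : Type*} {X : Set E} {F F' : Set (E → ℝ)} {D : ℝ≥0}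
    (h : HasCoveringExponent X F D) (hF : F' ⊆ F) : HasCoveringExponent X F' D := by
  obtain ⟨K, hK⟩ := h
  refine ⟨K * 2 ^ (D : ℝ), fun ε hε hε1 => ?_⟩
  calc (supCoveringNumber X F' ε : ℝ≥0∞) ≤ supCoveringNumber X F (ε / 2) :=
        ENat.toENNReal_le.2 (Metric.coveringNumber_subset_le (Set.image_mono hF))
    _ ≤ (K * (1 / (ε / 2)) ^ (D : ℝ) : ℝ≥0) :=
        hK _ (by positivity) ((NNReal.half_le_self ε).trans hε1)
    _ = (K * 2 ^ (D : ℝ) * (1 / ε) ^ (D : ℝ) : ℝ≥0) := by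
        rw [mul_assoc, ← NNReal.mul_rpow, one_div_div, mul_one_div]

theorem HasNetExponent.hasCoveringExponent {E : Type*} {X : Set E} {F : Set (E → ℝ)} {p : ℕ}
    (h : HasNetExponent X F p) : HasCoveringExponent X F p := by
  obtain ⟨K, hK, h⟩ := h
  lift K to ℝ≥0 using hK
  refine ⟨K, fun ε hε hε1 => ?_⟩
  obtain ⟨G, hGF, hcard, hG⟩ := h ε hε hε1
  have hcover : Metric.IsCover ε ((fun f : E → ℝ => UniformFun.ofFun (X.domRestrict f)) '' F)
      ((fun f : E → ℝ => UniformFun.ofFun (X.domRestrict f)) '' G) := by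
    rintro _ ⟨f, hf, rfl⟩
    obtain ⟨g, hg, hfg⟩ := hG f hf
    refine ⟨_, ⟨g, hg, rfl⟩, UniformFun.edist_le.2 fun x => ?_⟩
    exact (edist_le_coe (x := f x) (y := g x)).2 (hfg x x.2)
  have hle : supCoveringNumber X F ε ≤ G.card :=
    calc supCoveringNumber X F ε ≤ _ := hcover.coveringNumber_le_encard (Set.image_mono hGF)
      _ ≤ (G : Set (E → ℝ)).encard := Set.encard_image_le _ _
      _ = G.card := Set.encard_coe_eq_coe_finsetCard G
  calc (supCoveringNumber X F ε : ℝ≥0∞) ≤ ((G.card : ℝ≥0) : ℝ≥0∞) := by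
        simpa using ENat.toENNReal_le.2 hle
    _ ≤ (K * (1 / ε) ^ ((p : ℝ≥0) : ℝ) : ℝ≥0) := by
        rw [ENNReal.coe_le_coe, NNReal.coe_natCast, NNReal.rpow_natCast, one_div]
        exact_mod_cast hcard

theorem abs_dotProduct_le {ι : Type*} [Fintype ι] {a x : ι → ℝ} {b : ℝ} (ha : ∀ i, |a i| ≤ b) :
    |a ⬝ᵥ x| ≤ Fintype.card ι * b * ‖x‖ :=
  calc |a ⬝ᵥ x| ≤ ∑ i, |a i * x i| := Finset.abs_sum_le_sum_abs _ _
    _ ≤ ∑ _i : ι, b * ‖x‖ := by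
        refine Finset.sum_le_sum fun i _ => ?_
        rw [abs_mul]
        exact mul_le_mul (ha i) (norm_le_pi_norm x i) (abs_nonneg _) ((abs_nonneg _).trans (ha i))
    _ = Fintype.card ι * b * ‖x‖ := by simp [mul_assoc]

/-- Affine forms whose coefficients and constant term are bounded by `b`: the coordinates of the
affine layers `h_l` of a network. -/
def IsBoundedAffine {ι : Type*} [Fintype ι] (b : ℝ) (φ : (ι → ℝ) → ℝ) : Prop :=
  ∃ (a : ι → ℝ) (c : ℝ), (∀ i, |a i| ≤ b) ∧ |c| ≤ b ∧ ∀ x, φ x = a ⬝ᵥ x + c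

/-- The affine maps whose matrix entries and bias entries are bounded by `b`. -/
def affineLayers (b : ℝ) (ι κ : Type*) [Fintype ι] : Set ((ι → ℝ) → κ → ℝ) :=
  {f | ∀ k, IsBoundedAffine b fun x => f x k}

section Affine

variable {ι κ : Type*} [Fintype ι] {b : ℝ≥0} {f : (ι → ℝ) → κ → ℝ}

theorem IsBoundedAffine.abs_le {φ : (ι → ℝ) → ℝ} (h : IsBoundedAffine b φ) (x : ι → ℝ) :
    |φ x| ≤ b * (Fintype.card ι * ‖x‖ + 1) := by
  obtain ⟨a, c, ha, hc, h⟩ := h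
  calc |φ x| ≤ |a ⬝ᵥ x| + |c| := by
        rw [h]
        exact abs_add_le _ _
    _ ≤ Fintype.card ι * b * ‖x‖ + b := add_le_add (abs_dotProduct_le ha) hc
    _ = b * (Fintype.card ι * ‖x‖ + 1) := by ring

theorem IsBoundedAffine.lipschitzWith {φ : (ι → ℝ) → ℝ} (h : IsBoundedAffine b φ) :
    LipschitzWith (Fintype.card ι * b) φ := by
  obtain ⟨a, c, ha, -, h⟩ := h
  refine .of_dist_le_mul fun x y => ?_
  rw [h, h, dist_add_right, Real.dist_eq, ← dotProduct_sub, dist_eq_norm]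
  exact abs_dotProduct_le ha

variable [Fintype κ]

theorem norm_le_of_mem_affineLayers (hf : f ∈ affineLayers b ι κ) (x : ι → ℝ) :
    ‖f x‖ ≤ b * (Fintype.card ι * ‖x‖ + 1) :=
  (pi_norm_le_iff_of_nonneg (by positivity)).2 fun k => (hf k).abs_le x

theorem lipschitzWith_of_mem_affineLayers (hf : f ∈ affineLayers b ι κ) :
    LipschitzWith (Fintype.card ι * b) f :=
  .of_dist_le_mul fun x y => (dist_pi_le_iff (by positivity)).2 fun k =>
    (hf k).lipschitzWith.dist_le_mul x y

/-- The affine map with parameters `v`: the entry `v (k, some i)` multiplies the `i`-th input in the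
`k`-th output, and `v (k, none)` is the `k`-th bias. -/
def affineMapOfParams (v : κ × Option ι → ℝ) (x : ι → ℝ) (k : κ) : ℝ :=
  (fun i => v (k, some i)) ⬝ᵥ x + v (k, none)

theorem affineLayers_eq_image_closedBall :
    affineLayers b ι κ = affineMapOfParams '' Metric.closedBall 0 b := by
  ext f
  simp only [Set.mem_image, mem_closedBall_zero_iff, pi_norm_le_iff_of_nonneg b.coe_nonneg,
    Real.norm_eq_abs]
  constructor
  · intro hf
    choose a c ha hc h using hf
    refine ⟨fun q => q.2.elim (c q.1) (a q.1), ?_, funext₂ fun x k => (h k x).symm⟩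
    rintro ⟨k, _ | i⟩
    exacts [hc k, ha k i]
  · rintro ⟨v, hv, rfl⟩ k
    exact ⟨_, _, fun i => hv _, hv _, fun x => rfl⟩

theorem lipschitzWith_affineMapOfParams {R : ℝ≥0} {x : ι → ℝ} (hx : ‖x‖ ≤ R) :
    LipschitzWith (Fintype.card ι * R + 1) fun v : κ × Option ι → ℝ => affineMapOfParams v x := by
  refine .of_dist_le_mul fun v w => (dist_pi_le_iff (by positivity)).2 fun k => ?_
  have hvw : ∀ q, |v q - w q| ≤ dist v w := fun q => dist_le_pi_dist v w q
  calc dist (affineMapOfParams v x k) (affineMapOfParams w x k)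
      = |(fun i => v (k, some i) - w (k, some i)) ⬝ᵥ x + (v (k, none) - w (k, none))| := by
        rw [Real.dist_eq, affineMapOfParams, affineMapOfParams, add_sub_add_comm, ← sub_dotProduct]
        rfl
    _ ≤ Fintype.card ι * dist v w * ‖x‖ + dist v w :=
        (abs_add_le _ _).trans (add_le_add (abs_dotProduct_le fun i => hvw _) (hvw _))
    _ ≤ Fintype.card ι * dist v w * R + dist v w := by gcongr
    _ = (Fintype.card ι * R + 1 : ℝ≥0) * dist v w := by
        push_cast
        ring

theorem hasNetExponent_affineLayers (R : ℝ≥0) :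
    HasNetExponent (Metric.closedBall 0 R) (affineLayers b ι κ)
      (Fintype.card κ * (Fintype.card ι + 1)) := by
  have h := hasNetExponent_image_closedBall (P := affineMapOfParams (ι := ι) (κ := κ)) b.coe_nonneg
    (X := Metric.closedBall 0 R)
    fun x hx => (lipschitzWith_affineMapOfParams (mem_closedBall_zero_iff.1 hx)).lipschitzOnWith
  rw [affineLayers_eq_image_closedBall]
  simpa only [Fintype.card_prod, Fintype.card_option] using h

end Affine

namespace MLP

variable {W L d m : ℕ} {b : ℝ≥0}

theorem lipschitzWith_relu {n : ℕ} : LipschitzWith 1 (relu (n := n)) :=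
  .of_dist_le_mul fun v w => (dist_pi_le_iff (by positivity)).2 fun i =>
    ((LipschitzWith.id.const_max 0).dist_le_mul (v i) (w i)).trans
      (mul_le_mul_of_nonneg_left (dist_le_pi_dist v w i) zero_le_one)

theorem norm_relu_le {n : ℕ} (v : Fin n → ℝ) : ‖relu v‖ ≤ ‖v‖ := by
  have relu_zero : relu (0 : Fin n → ℝ) = 0 := funext fun _ => max_self 0
  simpa [relu_zero] using lipschitzWith_relu.dist_le_mul v 0

theorem le_width (N : MLP L d m) : d ≤ N.width := by
  cases N <;> exact le_max_left _ _

/-- The maps `ℝ^d → ℝ^m` computed by networks with `L` layers, width at most `W` and weights bounded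
by `b`; the vector-valued version of `mlpClass`. -/
def maps (W : ℕ) (b : ℝ) (L d m : ℕ) : Set ((Fin d → ℝ) → Fin m → ℝ) :=
  {f | ∃ N : MLP L d m, N.width ≤ W ∧ N.WeightsLE b ∧ N.eval = f}

theorem maps_one {b : ℝ} (hd : d ≤ W) (hm : m ≤ W) :
    maps W b 1 d m = affineLayers b (Fin d) (Fin m) := by
  ext f
  constructor
  · rintro ⟨N, -, hN, rfl⟩
    cases N with
    | last A c => exact fun k => ⟨A k, c k, hN.1 k, hN.2 k, fun x => rfl⟩
    | layer A c N => nomatch N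
  · intro hf
    choose A c hA hc h using hf
    exact ⟨.last A c, max_le hd hm, ⟨hA, hc⟩, funext₂ fun x k => (h k x).symm⟩

theorem maps_add_two {b : ℝ} (hd : d ≤ W) :
    maps W b (L + 2) d m = ⋃ k : Fin (W + 1), Set.image2 (· ∘ ·) (maps W b (L + 1) k m)
      ((relu ∘ ·) '' affineLayers b (Fin d) (Fin k)) := by
  ext f
  simp only [Set.mem_iUnion, Set.mem_image2, Set.exists_mem_image]
  constructor
  · rintro ⟨_ | ⟨A, c, N⟩, hw, hN, rfl⟩
    have hw' := max_le_iff.1 hw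
    refine ⟨⟨_, Nat.lt_succ_of_le (N.le_width.trans hw'.2)⟩, N.eval, ⟨N, hw'.2, hN.2.2, rfl⟩,
      fun x => A.mulVec x + c, fun k => ⟨A k, c k, hN.1 k, hN.2.1 k, fun x => rfl⟩, rfl⟩
  · rintro ⟨k, _, ⟨N, hw, hN, rfl⟩, f, hf, rfl⟩
    choose A c hA hc h using hf
    refine ⟨.layer A c N, max_le hd hw, ⟨hA, hc, hN⟩, funext fun x => ?_⟩
    exact congrArg (fun v => N.eval (relu v)) (funext fun k => (h k x).symm)

theorem lipschitzWith_of_mem_maps (hd : d ≤ W) (hm : m ≤ W) {f : (Fin d → ℝ) → Fin m → ℝ}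
    (hf : f ∈ maps W b (L + 1) d m) : LipschitzWith ((W * b) ^ (L + 1)) f := by
  have lipschitz_layer {d k : ℕ} (hd : d ≤ W) {h : (Fin d → ℝ) → Fin k → ℝ}
      (hh : h ∈ affineLayers b (Fin d) (Fin k)) : LipschitzWith (W * b) h :=
    (lipschitzWith_of_mem_affineLayers hh).weaken (by rw [Fintype.card_fin]; gcongr)
  induction L generalizing d with
  | zero => simpa using lipschitz_layer hd (maps_one hd hm ▸ hf)
  | succ L ih =>
    rw [maps_add_two hd] at hf
    obtain ⟨k, g, hg, _, ⟨h, hh, rfl⟩, rfl⟩ := Set.mem_iUnion.1 hf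
    rw [pow_succ, ← one_mul (W * b : ℝ≥0)]
    simpa [pow_succ] using (ih k.is_le hg).comp (lipschitzWith_relu.comp (lipschitz_layer hd hh))

theorem norm_le_of_mem_maps (hb : 1 ≤ b) (hd : d ≤ W) (hm : m ≤ W)
    {f : (Fin d → ℝ) → Fin m → ℝ} (hf : f ∈ maps W b (L + 1) d m) {x : Fin d → ℝ} {R : ℝ}
    (hR : 1 ≤ R) (hx : ‖x‖ ≤ R) : ‖f x‖ ≤ ((W + 1) * b) ^ (L + 1) * R := by
  have norm_layer {d k : ℕ} (hd : d ≤ W) {h : (Fin d → ℝ) → Fin k → ℝ}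
      (hh : h ∈ affineLayers b (Fin d) (Fin k)) {x : Fin d → ℝ} {R : ℝ} (hR : 1 ≤ R)
      (hx : ‖x‖ ≤ R) : ‖h x‖ ≤ (W + 1) * b * R :=
    calc ‖h x‖ ≤ b * (d * ‖x‖ + 1) := by simpa using norm_le_of_mem_affineLayers hh x
      _ ≤ b * (W * R + R) := by gcongr
      _ = (W + 1) * b * R := by ring
  induction L generalizing d R with
  | zero => simpa using norm_layer hd (maps_one hd hm ▸ hf) hR hx
  | succ L ih =>
    rw [maps_add_two hd] at hf
    obtain ⟨k, g, hg, _, ⟨h, hh, rfl⟩, rfl⟩ := Set.mem_iUnion.1 hf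
    have one_le : 1 ≤ (W + 1) * b * R := by
      have : (1 : ℝ) ≤ b := hb
      exact one_le_mul_of_one_le_of_one_le (one_le_mul_of_one_le_of_one_le (by simp) this) hR
    calc ‖g (relu (h x))‖ ≤ ((W + 1) * b) ^ (L + 1) * ((W + 1) * b * R) :=
          ih k.is_le hg one_le ((norm_relu_le _).trans (norm_layer hd hh hR hx))
      _ = ((W + 1) * b) ^ (L + 1 + 1) * R := by ring

theorem hasNetExponent_maps (hd : d ≤ W) (hm : m ≤ W) (R : ℝ≥0) :
    HasNetExponent (Metric.closedBall 0 R) (maps W b (L + 1) d m) ((L + 1) * (W * (W + 1))) := by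
  have layer_exponent {d k : ℕ} (hd : d ≤ W) (hk : k ≤ W) (R : ℝ≥0) :
      HasNetExponent (Metric.closedBall 0 R) (affineLayers b (Fin d) (Fin k)) (W * (W + 1)) :=
    (hasNetExponent_affineLayers R).mono subset_rfl
      (by simp only [Fintype.card_fin]; gcongr)
  induction L generalizing d R with
  | zero => simpa [maps_one hd hm] using layer_exponent hd hm R
  | succ L ih =>
    rw [maps_add_two hd, add_one_mul, add_comm (_ * _)]
    refine .iUnion fun k => ?_
    have hrelu := (layer_exponent hd k.is_le R).image_lipschitz_comp lipschitzWith_relu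
    refine hrelu.image2_comp (ih k.is_le (b * (d * R + 1))) ?_ fun g hg =>
      (lipschitzWith_of_mem_maps k.is_le hm hg).lipschitzOnWith
    rintro _ ⟨h, hh, rfl⟩ x hx
    rw [mem_closedBall_zero_iff] at hx ⊢
    refine (norm_relu_le _).trans ((norm_le_of_mem_affineLayers hh x).trans ?_)
    push_cast
    rw [Fintype.card_fin]
    gcongr

end MLP

theorem mlpClass_eq_image_maps (d W L : ℕ) (b : ℝ) :
    mlpClass d W L b = ((fun v : Fin 1 → ℝ => v 0) ∘ ·) '' MLP.maps W b L d 1 := by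
  ext f
  constructor
  · rintro ⟨N, hw, hN, hf⟩ 
    exact ⟨N.eval, ⟨N, hw, hN, rfl⟩, funext fun x => (hf x).symm⟩
  · rintro ⟨_, ⟨N, hw, hN, rfl⟩, rfl⟩
    exact ⟨N, hw, hN, fun x => rfl⟩

theorem hasCoveringExponent_mlpClass {d W L : ℕ} {b R : ℝ≥0} {X : Set (Fin d → ℝ)}
    (hW : 1 ≤ W) (hdW : d ≤ W) (hL : 1 ≤ L) (hX : X ⊆ Metric.closedBall 0 R) :
    HasCoveringExponent X (mlpClass d W L b) (L * (W * (W + 1)) : ℕ) := by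
  obtain ⟨L, rfl⟩ := Nat.exists_eq_add_of_le' hL
  rw [mlpClass_eq_image_maps]
  exact (((MLP.hasNetExponent_maps hdW hW R).mono hX le_rfl).image_lipschitz_comp
    (LipschitzWith.eval 0)).hasCoveringExponent

theorem abs_le_of_mem_mlpClass {d W L : ℕ} {b : ℝ≥0} (hb : 1 ≤ b) (hW : 1 ≤ W) (hdW : d ≤ W)
    (hL : 1 ≤ L) {f : (Fin d → ℝ) → ℝ} (hf : f ∈ mlpClass d W L b) {x : Fin d → ℝ} {R : ℝ}
    (hR : 1 ≤ R) (hx : ‖x‖ ≤ R) : |f x| ≤ ((W + 1) * b) ^ L * R := by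
  obtain ⟨L, rfl⟩ := Nat.exists_eq_add_of_le' hL
  rw [mlpClass_eq_image_maps] at hf
  obtain ⟨g, hg, rfl⟩ := hf
  exact (norm_le_pi_norm (g x) 0).trans (MLP.norm_le_of_mem_maps hb hdW hW hg hR hx)

section Separation

variable {E : Type*} {X : Set E} {F : Set (E → ℝ)} {D : ℝ≥0}

theorem card_le_supCoveringNumber {ι : Type*} [Fintype ι] {f : ι → E → ℝ} {ε : ℝ≥0}
    (hf : ∀ i, f i ∈ F) (hsep : Pairwise fun i j => ∃ x ∈ X, 2 * ε < |f i x - f j x|) :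
    (Fintype.card ι : ℕ∞) ≤ supCoveringNumber X F ε := by
  set r : (E → ℝ) → UniformFun X ℝ := fun g => UniformFun.ofFun (X.domRestrict g)
  have lt_edist : Pairwise fun i j => ((2 * ε : ℝ≥0) : ℝ≥0∞) < edist (r (f i)) (r (f j)) := by
    intro i j hij
    obtain ⟨x, hx, hlt⟩ := hsep hij
    refine lt_of_lt_of_le ?_ (UniformFun.edist_eval_le (x := ⟨x, hx⟩))
    rw [edist_nndist, ENNReal.coe_lt_coe, ← NNReal.coe_lt_coe]
    exact_mod_cast hlt
  have injective : Function.Injective fun i => r (f i) := fun i j hij => by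
    by_contra hne
    simpa [show r (f i) = r (f j) from hij] using lt_edist hne
  have separated : Metric.IsSeparated (2 * ε : ℝ≥0) (Set.range fun i => r (f i)) :=
    Pairwise.range_pairwise lt_edist
  calc (Fintype.card ι : ℕ∞) = (Set.range fun i => r (f i)).encard := by
        rw [← Set.image_univ, injective.encard_image, Set.encard_univ,
          ENat.card_eq_coe_fintype_card]
    _ ≤ Metric.packingNumber (2 * ε) (r '' F) :=
        separated.encard_le_packingNumber
          (Set.range_subset_iff.2 fun i => Set.mem_image_of_mem r (hf i))
    _ ≤ Metric.externalCoveringNumber ε (r '' F) :=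
        Metric.packingNumber_two_mul_le_externalCoveringNumber _ _
    _ ≤ supCoveringNumber X F ε := Metric.externalCoveringNumber_le_coveringNumber _ _

theorem HasCoveringExponent.le_of_pow_le {p : ℕ} {c : ℝ≥0} (hD : HasCoveringExponent X F D)
    (hc : 0 < c) (h : ∀ R : ℕ, 0 < R → (R ^ p : ℕ) ≤ supCoveringNumber X F (c / R)) :
    (p : ℝ≥0) ≤ D := by
  obtain ⟨K, hK⟩ := hD
  have le_mul_rpow (R : ℕ) (hR : 0 < R) (hcR : c ≤ R) :
      (R : ℝ) ^ (p : ℝ) ≤ K * (1 / c) ^ (D : ℝ) * (R : ℝ) ^ (D : ℝ) := by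
    have hle := (ENat.toENNReal_le.2 (h R hR)).trans
      (hK (c / R) (div_pos hc (by exact_mod_cast hR)) (div_le_one_of_le₀ hcR (by simp)))
    rw [ENat.toENNReal_coe, ← ENNReal.coe_natCast, ENNReal.coe_le_coe, one_div_div,
      ← mul_one_div, mul_comm (R : ℝ≥0), NNReal.mul_rpow, ← mul_assoc] at hle
    rw [Real.rpow_natCast]
    exact_mod_cast hle
  by_contra hlt
  have hexp : (0 : ℝ) < p - D := sub_pos.2 (by exact_mod_cast not_le.1 hlt)
  have tendsto := (tendsto_rpow_atTop hexp).comp tendsto_natCast_atTop_atTop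
  obtain ⟨R, hKR, hR, hcR⟩ := ((tendsto.eventually_gt_atTop (K * (1 / c) ^ (D : ℝ) : ℝ)).and
    ((Filter.eventually_gt_atTop 0).and (Filter.eventually_ge_atTop ⌈c⌉₊))).exists
  have hR' : (0 : ℝ) < R := by exact_mod_cast hR
  have hle := le_mul_rpow R hR (Nat.ceil_le.1 hcR)
  rw [← div_le_iff₀ (by positivity), ← Real.rpow_sub hR'] at hle
  exact hle.not_gt hKR

theorem dist_gridPoints_ge {ι : Type*} [Fintype ι] {R : ℕ} {δ : ℝ} (hδ : 0 ≤ δ)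
    {a a' : ι → Fin R} (h : a ≠ a') :
    δ ≤ dist (fun i => δ * (a i : ℕ)) (fun i => δ * (a' i : ℕ)) := by
  obtain ⟨i, hi⟩ := Function.ne_iff.1 h
  have one_le : (1 : ℝ) ≤ |((a i : ℕ) : ℝ) - (a' i : ℕ)| :=
    Nat.pairwise_one_le_dist (Fin.val_ne_of_ne hi)
  calc δ ≤ δ * |((a i : ℕ) : ℝ) - (a' i : ℕ)| := le_mul_of_one_le_right hδ one_le
    _ = dist (δ * (a i : ℕ)) (δ * (a' i : ℕ)) := by
        rw [Real.dist_eq, ← mul_sub, abs_mul, abs_of_nonneg hδ]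
    _ ≤ _ := dist_le_pi_dist (fun i => δ * ((a i : ℕ) : ℝ)) (fun i => δ * (a' i : ℕ)) i

theorem HasCoveringExponent.card_le_of_antilipschitz {ι : Type*} [Fintype ι] {δ : ℝ} {κ : ℝ≥0}
    {f : (ι → ℝ) → E → ℝ} (hD : HasCoveringExponent X F D) (hδ : 0 < δ) (hκ : 0 < κ)
    (hf : ∀ θ ∈ Set.Icc 0 (fun _ => δ), f θ ∈ F)
    (hsep : (Set.Icc 0 fun _ => δ).Pairwise fun θ θ' => ∃ x ∈ X,
      dist θ θ' ≤ κ * |f θ x - f θ' x|) :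
    (Fintype.card ι : ℝ≥0) ≤ D := by
  classical
  lift δ to ℝ≥0 using hδ.le
  have hδ' : 0 < δ := hδ
  refine hD.le_of_pow_le (c := δ / (3 * κ)) (by positivity) fun R hR => ?_
  have hR' : (0 : ℝ) < R := by exact_mod_cast hR
  set θ : (ι → Fin (R + 1)) → ι → ℝ := fun a i => δ / R * (a i : ℕ)
  have hθ (a) : θ a ∈ Set.Icc 0 (fun _ => (δ : ℝ)) := by
    refine ⟨fun i => by positivity, fun i => ?_⟩
    have : ((a i : ℕ) : ℝ) ≤ R := by exact_mod_cast (a i).is_le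
    calc θ a i ≤ δ / R * R := mul_le_mul_of_nonneg_left this (by positivity)
      _ = δ := div_mul_cancel₀ _ hR'.ne'
  calc ((R ^ Fintype.card ι : ℕ) : ℕ∞) ≤ (Fintype.card (ι → Fin (R + 1)) : ℕ) := by
        rw [Fintype.card_fun, Fintype.card_fin, Nat.cast_le]
        exact Nat.pow_le_pow_left R.le_succ _
    _ ≤ _ := card_le_supCoveringNumber (f := fun a => f (θ a)) (fun a => hf _ (hθ a)) ?_
  intro a a' ha
  have hgrid : (δ / R : ℝ) ≤ dist (θ a) (θ a') := dist_gridPoints_ge (by positivity) ha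
  have hne : θ a ≠ θ a' := dist_pos.1 (lt_of_lt_of_le (by positivity) hgrid)
  obtain ⟨x, hx, hdist⟩ := hsep (hθ a) (hθ a') hne
  refine ⟨x, hx, lt_of_mul_lt_mul_left ?_ κ.coe_nonneg⟩
  calc (κ : ℝ) * (2 * (δ / (3 * κ) / R : ℝ≥0)) = 2 / 3 * (δ / R) := by
        push_cast
        field_simp
    _ < δ / R := by linarith [show (0 : ℝ) < δ / R by positivity]
    _ ≤ κ * |f (θ a) x - f (θ a') x| := hgrid.trans hdist

theorem HasCoveringExponent.card_le_of_mulVec_injective {ι κ : Type*} [Fintype ι] [Finite κ]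
    {M : Matrix κ ι ℝ} {ξ : κ → E} {c : κ → ℝ} {δ : ℝ} (hD : HasCoveringExponent X F D)
    (hδ : 0 < δ) (hM : Function.Injective M.mulVec) (hξ : ∀ p, ξ p ∈ X)
    (hf : ∀ θ ∈ Set.Icc 0 (fun _ => δ), ∃ f ∈ F, ∀ p, f (ξ p) = M.mulVec θ p + c p) :
    (Fintype.card ι : ℝ≥0) ≤ D := by
  have := Fintype.ofFinite κ
  choose! f hfF hfξ using hf
  obtain ⟨K, hK, hanti⟩ := M.mulVecLin.exists_antilipschitzWith (LinearMap.ker_eq_bot.2 hM)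
  refine hD.card_le_of_antilipschitz hδ hK hfF fun θ hθ θ' hθ' hne => ?_
  have hsample (p) : f θ (ξ p) - f θ' (ξ p) = (M.mulVec θ - M.mulVec θ') p := by
    rw [hfξ θ hθ, hfξ θ' hθ', add_sub_add_right_eq_sub, Pi.sub_apply]
  by_contra! hlt
  have hpos : 0 < dist θ θ' / K := div_pos (dist_pos.2 hne) (NNReal.coe_pos.2 hK)
  have hnorm : ‖M.mulVec θ - M.mulVec θ'‖ < dist θ θ' / K := by
    refine (pi_norm_lt_iff hpos).2 fun p => ?_
    rw [Real.norm_eq_abs, ← hsample, lt_div_iff₀' (NNReal.coe_pos.2 hK)]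
    exact hlt _ (hξ p)
  rw [lt_div_iff₀' (NNReal.coe_pos.2 hK), ← dist_eq_norm] at hnorm
  exact (hanti.le_mul_dist θ θ').not_gt hnorm

end Separation

theorem MLP.WeightsLE.mono {b b' : ℝ} (h : b ≤ b') {L d m : ℕ} {N : MLP L d m}
    (hN : N.WeightsLE b) : N.WeightsLE b' := by
  induction N with
  | last A c => exact ⟨fun i j => (hN.1 i j).trans h, fun i => (hN.2 i).trans h⟩
  | layer A c N ih =>
    exact ⟨fun i j => (hN.1 i j).trans h, fun i => (hN.2.1 i).trans h, ih hN.2.2⟩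

theorem mlpClass_mono {d W L : ℕ} {b b' : ℝ} (h : b ≤ b') : mlpClass d W L b ⊆ mlpClass d W L b' :=
  fun _ ⟨N, hw, hN, hf⟩ => ⟨N, hw, hN.mono h, hf⟩

/-- The class `mlpClass` for inputs indexed by an arbitrary finite type: hidden layers are described
most easily when their units carry meaningful labels. Quantifying over all enumerations of the
labels avoids choosing one. -/
def mlpClassOn (ι : Type*) (W L : ℕ) (b : ℝ) : Set ((ι → ℝ) → ℝ) :=
  {f | ∀ (d : ℕ) (e : ι ≃ Fin d), (fun x : Fin d → ℝ => f (x ∘ e)) ∈ mlpClass d W L b}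

section LabelledUnits

variable {ι κ : Type*} [Fintype ι] {W L : ℕ} {b : ℝ}

theorem dotProduct_comp_equiv {d : ℕ} (e : ι ≃ Fin d) (a : ι → ℝ) (x : Fin d → ℝ) :
    a ⬝ᵥ (x ∘ e) = (a ∘ e.symm) ⬝ᵥ x :=
  Fintype.sum_equiv e _ _ fun i => by simp

theorem IsBoundedAffine.mem_mlpClassOn {φ : (ι → ℝ) → ℝ} (hφ : IsBoundedAffine b φ)
    (hι : Fintype.card ι ≤ W) (hW : 1 ≤ W) : φ ∈ mlpClassOn ι W 1 b := by
  intro d e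
  obtain ⟨a, c, ha, hc, h⟩ := hφ
  have hd : d ≤ W := by simpa [Fintype.card_congr e] using hι
  refine ⟨.last (.of fun _ => a ∘ e.symm) (fun _ => c), max_le hd hW,
    ⟨fun _ j => ha _, fun _ => hc⟩, fun x => (h _).trans ?_⟩
  rw [dotProduct_comp_equiv]
  rfl

theorem comp_relu_mem_mlpClassOn [Finite κ] {g : (κ → ℝ) → ℝ} {A : (ι → ℝ) → κ → ℝ}
    (hg : g ∈ mlpClassOn κ W L b) (hA : A ∈ affineLayers b ι κ) (hι : Fintype.card ι ≤ W) :
    (fun x => g fun k => max 0 (A x k)) ∈ mlpClassOn ι W (L + 1) b := by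
  intro d e
  choose a c ha hc hAac using hA
  have hd : d ≤ W := by simpa [Fintype.card_congr e] using hι
  obtain ⟨n, ⟨e'⟩⟩ := Finite.exists_equiv_fin κ
  obtain ⟨N, hw, hN, hf⟩ := hg _ e'
  refine ⟨.layer (.of fun p => a (e'.symm p) ∘ e.symm) (fun p => c (e'.symm p)) N,
    max_le hd hw, ⟨fun p j => ha _ _, fun p => hc _, hN⟩, fun x => ?_⟩
  rw [MLP.eval, ← hf]
  refine congrArg g (funext fun k => ?_)
  have hk : A (x ∘ e) k = a k ⬝ᵥ (x ∘ e) + c k := hAac k _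
  rw [hk, dotProduct_comp_equiv]
  simp only [Function.comp_apply, MLP.relu, Pi.add_apply, Matrix.mulVec, Matrix.of_apply,
    Equiv.symm_apply_apply, Function.comp_def]

end LabelledUnits

/-- The values of the units of a hidden layer: the network input `x`, an accumulator `a` for the
output, and working units `v`. Also used for coefficient vectors of forms in these units. -/
def hiddenState {κ : Type*} (x a : ℝ) (v : κ → ℝ) : Option (Option κ) → ℝ
  | none => x
  | some none => a
  | some (some k) => v k

section HiddenState

variable {κ κ' : Type*} [Fintype κ] {W L : ℕ} {b : ℝ}

theorem hiddenState_dotProduct (p q x a : ℝ) (w v : κ → ℝ) :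
    hiddenState p q w ⬝ᵥ hiddenState x a v = p * x + q * a + w ⬝ᵥ v := by
  simp only [dotProduct, Fintype.sum_option, hiddenState, add_assoc]

theorem isBoundedAffine_hiddenState_dotProduct {p q c : ℝ} {w : κ → ℝ} (hp : |p| ≤ b)
    (hq : |q| ≤ b) (hw : ∀ k, |w k| ≤ b) (hc : |c| ≤ b) :
    IsBoundedAffine b fun s => hiddenState p q w ⬝ᵥ s + c := by
  refine ⟨hiddenState p q w, c, ?_, hc, fun s => rfl⟩
  rintro (_ | _ | k)
  exacts [hp, hq, hw k]

theorem exists_mlpClassOn_hidden_layer [Finite κ'] {g : (Option (Option κ') → ℝ) → ℝ} {w : κ → ℝ}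
    {ρ : Matrix κ' κ ℝ} {p c : κ' → ℝ} (hg : g ∈ mlpClassOn (Option (Option κ')) W L 1)
    (hκ : Fintype.card κ + 2 ≤ W) (hw : ∀ k, |w k| ≤ 1) (hρ : ∀ l k, |ρ l k| ≤ 1)
    (hp : ∀ l, |p l| ≤ 1) (hc : ∀ l, |c l| ≤ 1) :
    ∃ f ∈ mlpClassOn (Option (Option κ)) W (L + 1) 1, ∀ (x a : ℝ) (v : κ → ℝ), 0 ≤ x →
      0 ≤ a + w ⬝ᵥ v → f (hiddenState x a v) =
        g (hiddenState x (a + w ⬝ᵥ v) fun l => max 0 (ρ.mulVec v l + p l * x + c l)) := by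
  set A : (Option (Option κ) → ℝ) → Option (Option κ') → ℝ := fun s => hiddenState
    (hiddenState 1 0 0 ⬝ᵥ s + 0) (hiddenState 0 1 w ⬝ᵥ s + 0)
    fun l => hiddenState (p l) 0 (ρ l) ⬝ᵥ s + c l
  have hA : A ∈ affineLayers 1 (Option (Option κ)) (Option (Option κ')) := by
    rintro (_ | _ | l)
    · exact isBoundedAffine_hiddenState_dotProduct (by simp) (by simp) (by simp) (by simp)
    · exact isBoundedAffine_hiddenState_dotProduct (by simp) (by simp) hw (by simp)
    · exact isBoundedAffine_hiddenState_dotProduct (hp l) (by simp) (hρ l) (hc l)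
  refine ⟨_, comp_relu_mem_mlpClassOn hg hA (by simpa only [Fintype.card_option] using hκ),
    fun x a v hx ha => congrArg g (funext ?_)⟩
  rintro (_ | _ | l)
  · simp [A, hiddenState_dotProduct, hiddenState, hx]
  · simp [A, hiddenState_dotProduct, hiddenState, ha]
  · simp [A, hiddenState_dotProduct, hiddenState, Matrix.mulVec, add_comm (p l * x)]

/-- From every hidden state `(x, a, v)`, some network with `L` layers, width at most `W` and weights
in `[-1, 1]` computes `a + ∑ k, v k + G x`. The contribution of the working units `v` is the output
of the preceding block, which has not been accumulated yet. -/
def IsAddable (κ : Type*) [Fintype κ] (W L : ℕ) (G : ℝ → ℝ) : Prop :=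
  ∃ g ∈ mlpClassOn (Option (Option κ)) W L 1, ∀ (x a : ℝ) (v : κ → ℝ), 0 ≤ x → 0 ≤ a →
    (∀ k, 0 ≤ v k) → g (hiddenState x a v) = a + ∑ k, v k + G x

namespace IsAddable

theorem zero_one (hκ : Fintype.card κ + 2 ≤ W) : IsAddable κ W 1 0 := by
  have hsum : IsBoundedAffine 1 fun s : Option (Option κ) → ℝ => hiddenState 0 1 1 ⬝ᵥ s + 0 :=
    isBoundedAffine_hiddenState_dotProduct (by simp) (by simp) (by simp) (by simp)
  refine ⟨_, hsum.mem_mlpClassOn (by simpa only [Fintype.card_option] using hκ) (by omega),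
    fun x a v _ _ _ => ?_⟩
  simp [hiddenState_dotProduct, one_dotProduct]

theorem succ {G : ℝ → ℝ} (hG : IsAddable κ W L G) (hκ : Fintype.card κ + 2 ≤ W) :
    IsAddable κ W (L + 1) G := by
  obtain ⟨g, hg, hgG⟩ := hG
  obtain ⟨f, hf, hfg⟩ := exists_mlpClassOn_hidden_layer hg hκ (w := 1) (ρ := 0) (p := 0) (c := 0)
    (by simp) (by simp) (by simp) (by simp)
  refine ⟨f, hf, fun x a v hx ha hv => ?_⟩
  have ha' : 0 ≤ a + 1 ⬝ᵥ v := by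
    rw [one_dotProduct]
    exact add_nonneg ha (Finset.sum_nonneg fun k _ => hv k)
  rw [hfg x a v hx ha', hgG _ _ _ hx ha' fun l => le_max_left _ _]
  simp [one_dotProduct]

theorem zero (hκ : Fintype.card κ + 2 ≤ W) (hL : 1 ≤ L) : IsAddable κ W L 0 := by
  induction L, hL using Nat.le_induction with
  | base => exact zero_one hκ
  | succ L _ ih => exact ih.succ hκ

theorem exists_mlpClass {d : ℕ} {G : ℝ → ℝ} (hG : IsAddable κ W L G) (hd : d ≤ W) (i : Fin d) :
    ∃ f ∈ mlpClass d W (L + 1) 1, ∀ x : Fin d → ℝ, 0 ≤ x i → f x = G (x i) := by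
  obtain ⟨g, hg, hgG⟩ := hG
  have hA : (fun x => hiddenState (x i) 0 0) ∈ affineLayers 1 (Fin d) (Option (Option κ)) := by
    rintro (_ | _ | k)
    · refine ⟨Pi.single i 1, 0, fun j => ?_, by simp, fun x => by simp [hiddenState]⟩
      by_cases hj : j = i <;> simp [hj]
    all_goals exact ⟨0, 0, by simp, by simp, by simp [hiddenState]⟩
  refine ⟨_, comp_relu_mem_mlpClassOn hg hA (by simpa using hd) d (.refl _), fun x hx => ?_⟩
  have hrelu : (fun k => max 0 (hiddenState (x i) 0 (0 : κ → ℝ) k)) = hiddenState (x i) 0 0 := by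
    ext (_ | _ | k) <;> simp [hiddenState, hx]
  simpa [hrelu] using hgG (x i) 0 0 hx le_rfl fun _ => le_rfl

end IsAddable

end HiddenState

/-- The output weights of the three ReLU units that make up a `tent`. -/
noncomputable def tentCoeff : Fin 3 → ℝ :=
  ![1 / 2, -1, 1 / 2]

theorem abs_tentCoeff_le (i : Fin 3) : |tentCoeff i| ≤ 1 := by
  fin_cases i <;> norm_num [tentCoeff, abs_le]

/-- The tent of slope `1 / 2` and height `h / 2` over `[t, t + 2 * h]`, as a combination of three
ReLU units. -/
noncomputable def tent (h t x : ℝ) : ℝ :=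
  ∑ i : Fin 3, tentCoeff i * max 0 (x - (t + i * h))

section Block

variable {ι κ : Type*} [Fintype κ]

/-- One tent at each of the knots `t k`. -/
noncomputable def sawtooth (h : ℝ) (t : κ → ℝ) (x : ℝ) : ℝ :=
  ∑ k, tent h (t k) x

theorem sawtooth_eq_mulVec (h : ℝ) (t : κ → ℝ) (x : ℝ) (i : ι) :
    sawtooth h t x = (Matrix.of fun (_ : ι) (q : κ × Fin 3) => tentCoeff q.2).mulVec
      (fun q => max 0 (x - (t q.1 + q.2 * h))) i := by
  simp only [sawtooth, tent, Matrix.mulVec, dotProduct, Matrix.of_apply, Fintype.sum_prod_type]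

variable [Fintype ι]

/-- The function added to the accumulator by one block of three hidden layers, which compute the
sawtooth at the knots `t`, its excess over the thresholds `τ`, and the gated combinations of these
features with weights `θ`. -/
noncomputable def blockFun (h : ℝ) (t : κ → ℝ) (τ : ι → ℝ) (θ : Matrix κ ι ℝ) (x : ℝ) : ℝ :=
  ∑ k, max 0 (θ.mulVec (fun i => max 0 (sawtooth h t x - τ i)) k + (x - t k))

theorem IsAddable.add_blockFun {W L : ℕ} {h : ℝ} {t : κ → ℝ} {τ : ι → ℝ} {θ : Matrix κ ι ℝ}
    {G : ℝ → ℝ} (hG : IsAddable κ W L G) (hκ : 3 * Fintype.card κ + 2 ≤ W)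
    (hι : Fintype.card ι + 2 ≤ W) (hh : 0 ≤ h) (ht : ∀ k, 0 ≤ t k) (ht' : ∀ k, t k + 2 * h ≤ 1)
    (hτ : ∀ i, |τ i| ≤ 1) (hθ : ∀ k i, |θ k i| ≤ 1) :
    IsAddable κ W (L + 3) (blockFun h t τ θ + G) := by
  obtain ⟨g, hg, hgG⟩ := hG
  have hκ' : Fintype.card (κ × Fin 3) + 2 ≤ W := by
    rw [Fintype.card_prod, Fintype.card_fin]
    omega
  have hgate : ∀ k, |-t k| ≤ 1 := fun k => by
    rw [abs_neg, abs_of_nonneg (ht k)]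
    linarith [ht' k]
  have hshift : ∀ q : κ × Fin 3, |-(t q.1 + q.2 * h)| ≤ 1 := fun q => by
    have hq : ((q.2 : ℕ) : ℝ) ≤ 2 := by exact_mod_cast q.2.is_le
    have := ht q.1
    rw [abs_neg, abs_of_nonneg (by positivity)]
    linarith [ht' q.1, mul_le_mul_of_nonneg_right hq hh]
  obtain ⟨g₃, hg₃, gates⟩ := exists_mlpClassOn_hidden_layer hg hι (w := 0) (ρ := θ) (p := 1)
    (c := fun k => -t k) (by simp) hθ (by simp) hgate
  obtain ⟨g₂, hg₂, features⟩ := exists_mlpClassOn_hidden_layer hg₃ hκ' (w := 0)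
    (ρ := (.of fun _ q => tentCoeff q.2 : Matrix ι (κ × Fin 3) ℝ)) (p := 0)
    (c := fun i => -τ i) (by simp) (fun _ q => abs_tentCoeff_le q.2) (by simp) (by simpa using hτ)
  obtain ⟨g₁, hg₁, tents⟩ := exists_mlpClassOn_hidden_layer hg₂ (by omega) (w := 1)
    (ρ := (0 : Matrix (κ × Fin 3) κ ℝ)) (p := 1) (c := fun q => -(t q.1 + q.2 * h))
    (by simp) (by simp) (by simp) hshift
  refine ⟨g₁, hg₁, fun x a v hx ha hv => ?_⟩
  have ha' : 0 ≤ a + 1 ⬝ᵥ v := by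
    rw [one_dotProduct]
    exact add_nonneg ha (Finset.sum_nonneg fun k _ => hv k)
  rw [tents x a v hx ha', features _ _ _ hx (by simpa using ha'),
    gates _ _ _ hx (by simpa using ha'),
    hgG _ _ _ hx (by simpa using ha') fun k => le_max_left _ _]
  simp only [Matrix.zero_mulVec, zero_dotProduct, one_dotProduct, Pi.zero_apply, Pi.one_apply,
    one_mul, zero_mul, zero_add, add_zero, ← sub_eq_add_neg, ← sawtooth_eq_mulVec, add_sub_assoc,
    Pi.add_apply, blockFun, add_assoc]

theorem isAddable_sum_blockFun {W L m : ℕ} {h : ℝ} {t : Fin m → κ → ℝ} {τ : ι → ℝ}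
    {θ : Fin m → Matrix κ ι ℝ} (hκ : 3 * Fintype.card κ + 2 ≤ W) (hι : Fintype.card ι + 2 ≤ W)
    (hL : 3 * m + 1 ≤ L) (hh : 0 ≤ h) (ht : ∀ j k, 0 ≤ t j k) (ht' : ∀ j k, t j k + 2 * h ≤ 1)
    (hτ : ∀ i, |τ i| ≤ 1) (hθ : ∀ j k i, |θ j k i| ≤ 1) :
    IsAddable κ W L (∑ j, blockFun h (t j) τ (θ j)) := by
  induction m generalizing L with
  | zero => simpa using IsAddable.zero (by omega) (by omega)
  | succ m ih =>
    obtain ⟨L, rfl⟩ := Nat.exists_eq_add_of_le' (show 3 ≤ L by omega)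
    rw [Fin.sum_univ_succ]
    exact (ih (by omega) (fun j => ht j.succ) (fun j => ht' j.succ) fun j => hθ j.succ).add_blockFun
      hκ hι hh (ht 0) (ht' 0) hτ (hθ 0)

end Block

theorem max_zero_add_eq_ite_add {u y : ℝ} (hu : 0 ≤ u) (huy : 0 ≤ y ∨ u + y ≤ 0) :
    max 0 (u + y) = (if 0 ≤ y then u else 0) + max 0 y := by
  split_ifs with hy
  · rw [max_eq_right hy, max_eq_right (add_nonneg hu hy)]
  · rw [max_eq_left (huy.resolve_left hy), max_eq_left (not_le.1 hy).le, add_zero]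

section Tent

variable {h s t t' x : ℝ}

theorem tent_eq (h t x : ℝ) :
    tent h t x = max 0 (x - t) / 2 - max 0 (x - (t + h)) + max 0 (x - (t + 2 * h)) / 2 := by
  simp [tent, tentCoeff, Fin.sum_univ_three]
  ring

theorem tent_eq_zero_of_le (hh : 0 ≤ h) (hx : x ≤ t) : tent h t x = 0 := by
  rw [tent_eq, max_eq_left (by linarith), max_eq_left (by linarith), max_eq_left (by linarith)]
  norm_num

theorem tent_eq_zero_of_ge (hh : 0 ≤ h) (hx : t + 2 * h ≤ x) : tent h t x = 0 := by
  rw [tent_eq, max_eq_right (by linarith), max_eq_right (by linarith), max_eq_right (by linarith)]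
  ring

theorem tent_add (hs : 0 ≤ s) (hsh : s ≤ h) : tent h t (t + s) = s / 2 := by
  rw [tent_eq, max_eq_right (by linarith), max_eq_left (by linarith), max_eq_left (by linarith)]
  ring

theorem tent_add_eq_zero_of_separated (htt' : 2 * h ≤ |t - t'|) (hs : 0 ≤ s) (hsh : s ≤ h) :
    tent h t' (t + s) = 0 := by
  rcases le_abs.1 htt' with hgt | hlt
  · exact tent_eq_zero_of_ge (hs.trans hsh) (by linarith)
  · exact tent_eq_zero_of_le (hs.trans hsh) (by linarith)

end Tent

section Sampling

variable {ι κ : Type*} [Fintype ι] [Fintype κ] {h s x : ℝ} {τ : ι → ℝ}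

theorem sawtooth_knot_add {t : κ → ℝ} (ht : Pairwise fun k l => 2 * h ≤ |t k - t l|) (hs : 0 ≤ s)
    (hsh : s ≤ h) (k : κ) : sawtooth h t (t k + s) = s / 2 :=
  (Fintype.sum_eq_single k fun _ hl => tent_add_eq_zero_of_separated (ht hl.symm) hs hsh).trans
    (tent_add hs hsh)

-- A gate that is closed at `x` stays closed, since the features contribute at most `h`.
theorem blockFun_eq_sum_ite_add {t : κ → ℝ} {θ : Matrix κ ι ℝ} (hτ : ∀ i, 0 ≤ τ i)
    (hθ : ∀ k i, 0 ≤ θ k i) (hθ' : ∀ k, ∑ i, θ k i ≤ 1) (hx : 0 ≤ sawtooth h t x)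
    (hxh : sawtooth h t x ≤ h) (hgate : ∀ k, t k ≤ x ∨ x + h ≤ t k) :
    blockFun h t τ θ x =
      ∑ k, (if t k ≤ x then θ.mulVec (fun i => max 0 (sawtooth h t x - τ i)) k else 0) +
        ∑ k, max 0 (x - t k) := by
  rw [blockFun, ← Finset.sum_add_distrib]
  refine Finset.sum_congr rfl fun k _ => ?_
  have hnonneg : 0 ≤ θ.mulVec (fun i => max 0 (sawtooth h t x - τ i)) k :=
    Finset.sum_nonneg fun i _ => mul_nonneg (hθ k i) (le_max_left _ _)
  have hle : θ.mulVec (fun i => max 0 (sawtooth h t x - τ i)) k ≤ h := by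
    calc ∑ i, θ k i * max 0 (sawtooth h t x - τ i)
      _ ≤ ∑ i, θ k i * h := by
        gcongr with i
        · exact hθ k i
        · exact max_le (hx.trans hxh) (by linarith [hτ i])
      _ ≤ h := by
        rw [← Finset.sum_mul]
        exact mul_le_of_le_one_left (hx.trans hxh) (hθ' k)
  rw [max_zero_add_eq_ite_add hnonneg]
  · simp only [sub_nonneg]
  · exact (hgate k).imp sub_nonneg.2 fun hk => by linarith

theorem sum_blockFun_knot_add {m : ℕ} {t : Fin m → κ → ℝ} {θ : Fin m → Matrix κ ι ℝ}
    (ht : Pairwise fun p q : Fin m × κ => 2 * h ≤ |t p.1 p.2 - t q.1 q.2|) (hτ : ∀ i, 0 ≤ τ i)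
    (hθ : ∀ j k i, 0 ≤ θ j k i) (hθ' : ∀ j k, ∑ i, θ j k i ≤ 1) (hs : 0 ≤ s) (hsh : s ≤ h)
    (j : Fin m) (k : κ) :
    ∑ j', blockFun h (t j') τ (θ j') (t j k + s) =
      ∑ k', (if t j k' ≤ t j k then (θ j).mulVec (fun i => max 0 (s / 2 - τ i)) k' else 0) +
        ∑ j', ∑ k', max 0 (t j k + s - t j' k') := by
  have hsep : ∀ j' k', (j, k) ≠ (j', k') → 2 * h ≤ |t j k - t j' k'| := fun _ _ hp => ht hp
  have hgate : ∀ j' k', t j' k' ≤ t j k ∨ t j k + 2 * h ≤ t j' k' := fun j' k' => by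
    by_cases hp : ((j, k) : Fin m × κ) = (j', k')
    · obtain ⟨rfl, rfl⟩ := Prod.ext_iff.1 hp
      exact .inl le_rfl
    · exact (le_abs.1 (hsep j' k' hp)).imp (fun _ => by linarith) fun _ => by linarith
  have hown : sawtooth h (t j) (t j k + s) = s / 2 :=
    sawtooth_knot_add (t := t j) (ht.comp_of_injective (Prod.mk_right_injective j)) hs hsh k
  have hother : ∀ j' ≠ j, sawtooth h (t j') (t j k + s) = 0 := fun j' hj' =>
    Finset.sum_eq_zero fun k' _ =>
      tent_add_eq_zero_of_separated (hsep j' k' fun hp => hj' (Prod.ext_iff.1 hp).1.symm) hs hsh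
  have hblock : ∀ j', 0 ≤ sawtooth h (t j') (t j k + s) ∧ sawtooth h (t j') (t j k + s) ≤ h := by
    intro j'
    by_cases hj' : j' = j
    · rw [hj', hown]
      constructor <;> linarith
    · rw [hother j' hj']
      exact ⟨le_rfl, hs.trans hsh⟩
  have hsum : ∀ j', _ := fun j' => blockFun_eq_sum_ite_add hτ (hθ j') (hθ' j') (hblock j').1
    (hblock j').2 fun k' => (hgate j' k').imp (fun _ => by linarith) fun _ => by linarith
  rw [Finset.sum_congr rfl fun j' _ => hsum j', Finset.sum_add_distrib, Fintype.sum_eq_single j]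
  · congr! 3 with k'
    · exact ⟨fun hk' => (hgate j k').elim id fun _ => by linarith, fun _ => by linarith⟩
    · rw [hown]
  · intro j' hj'
    have hfeatures : (fun i => max 0 (sawtooth h (t j') (t j k + s) - τ i)) = 0 :=
      funext fun i => max_eq_left (by linarith [hother j' hj', hτ i])
    simp only [hfeatures, Matrix.mulVec_zero, Pi.zero_apply, ite_self, Finset.sum_const_zero]

end Sampling

section SamplingMatrix

open scoped Kronecker

/-- The matrix of the dependence of the sampled values on the weights `θ`. The sample `(j, k, l)`
lies to the right of the knot `(j, k)`, at the distance `2 * (l + 1) * η` where the sawtooth takes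
the value `(l + 1) * η`; the weight `(j, k', i)` acts through the gate `k'` on the feature with
threshold `i * η`. -/
noncomputable def samplingMatrix (m n : ℕ) (η : ℝ) :
    Matrix (Fin m × Fin n × Fin n) (Fin m × Fin n × Fin n) ℝ :=
  1 ⊗ₖ ((Matrix.of fun k k' => if k' ≤ k then 1 else 0) ⊗ₖ
    Matrix.of fun l i => max 0 ((l + 1) * η - i * η))

theorem samplingMatrix_mulVec_injective (m n : ℕ) {η : ℝ} (hη : 0 < η) :
    Function.Injective (samplingMatrix m n η).mulVec := by
  have hgates : (Matrix.of fun k k' : Fin n => if k' ≤ k then (1 : ℝ) else 0).det = 1 := by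
    rw [Matrix.det_of_isLowerTriangular _ fun k k' hk => ?_]
    · simp
    · exact if_neg (not_le.2 hk)
  have hfeatures :
      (Matrix.of fun l i : Fin n => max 0 (((l : ℕ) + 1) * η - (i : ℕ) * η)).det = η ^ n := by
    rw [Matrix.det_of_isLowerTriangular _ fun l i hl => ?_]
    · simp [add_mul, hη.le]
    · have hli : ((l : ℕ) : ℝ) + 1 ≤ (i : ℕ) := by exact_mod_cast hl
      exact max_eq_left (sub_nonpos.2 (by gcongr))
  apply Matrix.mulVec_injective_of_isUnit
  rw [Matrix.isUnit_iff_isUnit_det, isUnit_iff_ne_zero, samplingMatrix, Matrix.det_kronecker,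
    Matrix.det_kronecker, hgates, hfeatures, Matrix.det_one]
  simp [hη.ne']

theorem samplingMatrix_mulVec (m n : ℕ) (η : ℝ) (θ : Fin m × Fin n × Fin n → ℝ)
    (j : Fin m) (k l : Fin n) :
    (samplingMatrix m n η).mulVec θ (j, k, l) =
      ∑ k', if k' ≤ k then
        (Matrix.of fun k i => θ (j, k, i)).mulVec (fun i => max 0 ((l + 1) * η - i * η)) k'
      else 0 := by
  simp only [Matrix.mulVec, dotProduct, samplingMatrix, Matrix.kroneckerMap_apply, Matrix.one_apply,
    Fintype.sum_prod_type, Matrix.of_apply, mul_comm (θ _), ite_mul, one_mul, zero_mul,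
    Finset.sum_ite_irrel, Finset.sum_const_zero, Finset.sum_ite_eq, Finset.mem_univ, if_true]

end SamplingMatrix

section Knots

variable {m n : ℕ} {h : ℝ}

/-- `m * n` equally spaced knots `0, 2 * h, 4 * h, …`, in `m` consecutive groups of `n`. -/
noncomputable def knot (h : ℝ) (j : Fin m) (k : Fin n) : ℝ :=
  2 * h * (finProdFinEquiv (j, k) : ℕ)

theorem knot_nonneg (hh : 0 ≤ h) (j : Fin m) (k : Fin n) : 0 ≤ knot h j k := by
  unfold knot
  positivity

theorem knot_add_le (hh : 0 ≤ h) (j : Fin m) (k : Fin n) :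
    knot h j k + 2 * h ≤ 2 * h * (m * n) := by
  have hlt : ((finProdFinEquiv (j, k) : ℕ) : ℝ) + 1 ≤ m * n := by
    exact_mod_cast (finProdFinEquiv (j, k)).is_lt
  rw [knot]
  nlinarith

theorem knot_separated (hh : 0 ≤ h) :
    Pairwise fun p q : Fin m × Fin n => 2 * h ≤ |knot h p.1 p.2 - knot h q.1 q.2| := by
  intro p q hpq
  have hone : (1 : ℝ) ≤ |((finProdFinEquiv p : ℕ) : ℝ) - (finProdFinEquiv q : ℕ)| :=
    Nat.pairwise_one_le_dist (Fin.val_ne_of_ne (finProdFinEquiv.injective.ne hpq))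
  rw [knot, knot, ← mul_sub, abs_mul, abs_of_nonneg (by positivity : 0 ≤ 2 * h)]
  exact le_mul_of_one_le_right (by positivity) hone

theorem knot_le_knot (hh : 0 < h) (j : Fin m) (k k' : Fin n) :
    knot h j k' ≤ knot h j k ↔ k' ≤ k := by
  rw [knot, knot, mul_le_mul_iff_right₀ (by positivity), Nat.cast_le]
  simp [finProdFinEquiv]

end Knots

theorem exists_mlpClass_sample_eq {d W L m n : ℕ} {h η : ℝ} {θ : Fin m × Fin n × Fin n → ℝ}
    (hdW : d ≤ W) (hW : 3 * n + 2 ≤ W) (hL : 3 * m + 2 ≤ L) (hh : 0 < h) (hh' : h ≤ 1)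
    (hmn : 2 * h * (m * n) ≤ 1) (hη : 0 ≤ η) (hηh : 2 * n * η ≤ h)
    (hθ : θ ∈ Set.Icc 0 fun _ => ((n : ℝ) + 1)⁻¹) (r : Fin d) :
    ∃ f ∈ mlpClass d W L 1, ∀ (j : Fin m) (k l : Fin n) (x : Fin d → ℝ),
      x r = knot h j k + 2 * (l + 1) * η →
        f x = (samplingMatrix m n η).mulVec θ (j, k, l) +
          ∑ j' : Fin m, ∑ k' : Fin n, max 0 (knot h j k + 2 * (l + 1) * η - knot h j' k') := by
  obtain ⟨L, rfl⟩ := Nat.exists_eq_add_of_le' (show 1 ≤ L by omega)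
  set Θ : Fin m → Matrix (Fin n) (Fin n) ℝ := fun j => .of fun k i => θ (j, k, i)
  have hone_le : ∀ l : Fin n, ((l : ℕ) : ℝ) + 1 ≤ n := fun l => by exact_mod_cast l.is_lt
  have hΘ : ∀ j k i, 0 ≤ Θ j k i := fun _ _ _ => hθ.1 _
  have hΘ' : ∀ j k i, |Θ j k i| ≤ 1 := fun j k i =>
    (abs_of_nonneg (hΘ j k i)).trans_le ((hθ.2 _).trans (inv_le_one_of_one_le₀ (by simp)))
  have hrow : ∀ j k, ∑ i, Θ j k i ≤ 1 := fun j k => by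
    calc ∑ i, Θ j k i ≤ ∑ _i : Fin n, ((n : ℝ) + 1)⁻¹ := Finset.sum_le_sum fun _ _ => hθ.2 _
      _ = n / (n + 1) := by simp [div_eq_mul_inv]
      _ ≤ 1 := div_le_one_of_le₀ (by linarith) (by positivity)
  have hτ : ∀ i : Fin n, |(i : ℕ) * η| ≤ 1 := fun i => by
    rw [abs_of_nonneg (by positivity)]
    nlinarith [hone_le i]
  have hG : IsAddable (Fin n) W L (∑ j, blockFun h (knot h j) (fun i : Fin n => i * η) (Θ j)) :=
    isAddable_sum_blockFun (by simpa using hW) (by rw [Fintype.card_fin]; omega) (by omega) hh.le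
      (knot_nonneg hh.le) (fun j k => (knot_add_le hh.le j k).trans hmn) hτ hΘ'
  obtain ⟨f, hf, hfx⟩ := hG.exists_mlpClass hdW r
  refine ⟨f, hf, fun j k l x hx => ?_⟩
  have hs : 0 ≤ 2 * ((l : ℕ) + 1) * η := by positivity
  have hsh : 2 * ((l : ℕ) + 1) * η ≤ h := hηh.trans' (by gcongr; exact hone_le l)
  have hhalf : 2 * ((l : ℕ) + 1) * η / 2 = ((l : ℕ) + 1) * η := by ring
  have hx₀ : 0 ≤ x r := hx ▸ add_nonneg (knot_nonneg hh.le j k) hs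
  rw [hfx x hx₀, Finset.sum_apply, hx, sum_blockFun_knot_add (knot_separated hh.le)
    (fun i => by positivity) hΘ hrow hs hsh j k, samplingMatrix_mulVec]
  simp only [hhalf, knot_le_knot hh, Θ]

theorem mul_sq_le_of_hasCoveringExponent_mlpClass {d W L m n : ℕ} {b : ℝ} {D : ℝ≥0} (hd : 1 ≤ d)
    (hdW : d ≤ W) (hb : 1 ≤ b) (hW : 3 * n + 2 ≤ W) (hL : 3 * m + 2 ≤ L)
    (hD : HasCoveringExponent (Set.Icc 0 1) (mlpClass d W L b) D) : (m * n ^ 2 : ℝ≥0) ≤ D := by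
  set h : ℝ := 1 / (2 * (m * n + 1))
  set η : ℝ := h / (2 * (n + 1))
  have hh : 0 < h := by positivity
  have hη : 0 < η := by positivity
  have hmn : 2 * h * (m * n + 1) = 1 := by simp only [h]; field_simp
  have hηh : 2 * η * (n + 1) = h := by simp only [η]; field_simp
  have hh' : h ≤ 1 := by nlinarith [(by positivity : (0 : ℝ) ≤ h * (m * n))]
  set ξ : Fin m × Fin n × Fin n → Fin d → ℝ := fun p _ => knot h p.1 p.2.1 + 2 * (p.2.2 + 1) * η
  have hξ : ∀ p, ξ p ∈ Set.Icc 0 1 := by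
    rintro ⟨j, k, l⟩
    have hl : ((l : ℕ) : ℝ) + 1 ≤ n := by exact_mod_cast l.is_lt
    have hknot := knot_nonneg hh.le j k
    have hknot' := knot_add_le hh.le j k
    have hs : ((l : ℕ) + 1) * η ≤ n * η := by gcongr
    exact ⟨fun _ => by positivity, fun _ => show knot h j k + 2 * (l + 1) * η ≤ 1 by linarith⟩
  have hcard := hD.card_le_of_mulVec_injective (by positivity : (0 : ℝ) < ((n : ℝ) + 1)⁻¹)
    (samplingMatrix_mulVec_injective m n hη) hξ (c := fun p => ∑ j' : Fin m, ∑ k' : Fin n,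
      max 0 (knot h p.1 p.2.1 + 2 * (p.2.2 + 1) * η - knot h j' k')) fun θ hθ => by
    obtain ⟨f, hf, hfx⟩ := exists_mlpClass_sample_eq hdW hW hL hh hh' (by linarith) hη.le
      (by linarith) hθ ⟨0, hd⟩
    exact ⟨f, mlpClass_mono hb hf, fun p => hfx p.1 p.2.1 p.2.2 (ξ p) rfl⟩
  simpa [sq] using hcard

theorem sq_mul_le_of_hasCoveringExponent_mlpClass {d W L : ℕ} {b : ℝ} {D : ℝ≥0} (hd : 1 ≤ d)
    (hdW : d ≤ W) (hb : 1 ≤ b) (hW : 5 ≤ W) (hL : 5 ≤ L)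
    (hD : HasCoveringExponent (Set.Icc 0 1) (mlpClass d W L b) D) :
    (1 / 343 * W ^ 2 * L : ℝ≥0) ≤ D := by
  obtain ⟨n, hnW, hWn⟩ : ∃ n, 3 * n + 2 ≤ W ∧ W ≤ 7 * n := ⟨(W - 2) / 3, by omega, by omega⟩
  obtain ⟨m, hmL, hLm⟩ : ∃ m, 3 * m + 2 ≤ L ∧ L ≤ 7 * m := ⟨(L - 2) / 3, by omega, by omega⟩
  have hWn' : (W : ℝ≥0) ≤ 7 * n := by exact_mod_cast hWn
  have hLm' : (L : ℝ≥0) ≤ 7 * m := by exact_mod_cast hLm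
  calc (1 / 343 * W ^ 2 * L : ℝ≥0)
    _ ≤ 1 / 343 * (7 * n) ^ 2 * (7 * m) := by gcongr
    _ = m * n ^ 2 := by ring
    _ ≤ D := mul_sq_le_of_hasCoveringExponent_mlpClass hd hdW hb hnW hmL hD

theorem norm_le_one_of_mem_Icc_zero_one {ι : Type*} [Fintype ι] {x : ι → ℝ}
    (hx : x ∈ Set.Icc 0 1) : ‖x‖ ≤ 1 :=
  (pi_norm_le_iff_of_nonneg zero_le_one).2 fun i =>
    (Real.norm_of_nonneg (hx.1 i)).trans_le (hx.2 i)

theorem theorem7_general :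
    ∃ c C : ℝ≥0, 0 < c ∧ 0 < C ∧
      ∀ (d W L : ℕ) (b B : ℝ), 1 ≤ d → d ≤ W → 1 ≤ L → 1 ≤ b → (((W : ℝ) + 1) * b) ^ L ≤ B →
        (∀ (X : Set (Fin d → ℝ)) (F : Set ((Fin d → ℝ) → ℝ)),
          X ⊆ Set.Icc 0 1 → F ⊆ mlpClass d W L b →
            (∃ D : ℝ≥0, D ≤ C * (W : ℝ≥0) ^ 2 * (L : ℝ≥0) ∧ BoundedCovering X F B D) ∧
            effectiveDim X F ≤ ((C * (W : ℝ≥0) ^ 2 * (L : ℝ≥0) : ℝ≥0) : ℝ≥0∞)) ∧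
        (5 ≤ W → 5 ≤ L →
          ((c * (W : ℝ≥0) ^ 2 * (L : ℝ≥0) : ℝ≥0) : ℝ≥0∞) ≤
              effectiveDim (Set.Icc (0 : Fin d → ℝ) 1) (mlpClass d W L b) ∧
            effectiveDim (Set.Icc (0 : Fin d → ℝ) 1) (mlpClass d W L b) ≤
              ((C * (W : ℝ≥0) ^ 2 * (L : ℝ≥0) : ℝ≥0) : ℝ≥0∞)) := by
  refine ⟨1 / 343, 2, by norm_num, by norm_num, fun d W L b B hd hdW hL hb hB => ?_⟩
  lift b to ℝ≥0 using zero_le_one.trans hb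
  have hW : 1 ≤ W := hd.trans hdW
  have hparams : ((L * (W * (W + 1)) : ℕ) : ℝ≥0) ≤ 2 * W ^ 2 * L := by
    exact_mod_cast (by nlinarith [Nat.mul_le_mul_left (L * W) hW] :
      L * (W * (W + 1)) ≤ 2 * W ^ 2 * L)
  have hcov : ∀ {X F}, X ⊆ Set.Icc 0 1 → F ⊆ mlpClass d W L b →
      HasCoveringExponent X F (L * (W * (W + 1)) : ℕ) := fun hX hF =>
    (hasCoveringExponent_mlpClass (R := 1) hW hdW hL fun x hx =>
      mem_closedBall_zero_iff.2 (norm_le_one_of_mem_Icc_zero_one (hX hx))).subset hF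
  have hdim : ∀ {X F}, X ⊆ Set.Icc 0 1 → F ⊆ mlpClass d W L b →
      effectiveDim X F ≤ ((2 * W ^ 2 * L : ℝ≥0) : ℝ≥0∞) := fun hX hF =>
    iInf₂_le_of_le _ (hcov hX hF) (ENNReal.coe_le_coe.2 hparams)
  have hbound : ∀ f ∈ mlpClass d W L b, ∀ x ∈ Set.Icc 0 1, f x ∈ Set.Icc (-B) B := fun f hf x hx =>
    abs_le.1 <| (abs_le_of_mem_mlpClass hb hW hdW hL hf le_rfl
      (norm_le_one_of_mem_Icc_zero_one hx)).trans ((mul_one _).trans_le hB)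
  exact ⟨fun X F hX hF => ⟨⟨_, hparams, hX, fun f hf x hx => hbound f (hF hf) x (hX hx),
    hcov hX hF⟩, hdim hX hF⟩, fun hW5 hL5 => ⟨le_iInf₂ fun D hD => ENNReal.coe_le_coe.2 <|
      sq_mul_le_of_hasCoveringExponent_mlpClass hd hdW hb hW5 hL5 hD, hdim le_rfl le_rfl⟩⟩

theorem theorem7 :
    ∃ c C : ℝ≥0, 0 < c ∧ 0 < C ∧
      ∀ (d W L : ℕ) (b B : ℝ), 1 ≤ d → d ≤ W → 1 ≤ L → 1 ≤ b → (((W : ℝ) + 1) * b) ^ L ≤ B →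
        (∀ (X : Set (Fin d → ℝ)) (F : Set ((Fin d → ℝ) → ℝ)),
          X ⊆ Set.Icc 0 1 → F ⊆ mlpClass d W L b →
            (∃ D : ℝ≥0, D ≤ C * (W : ℝ≥0) ^ 2 * (L : ℝ≥0) ∧ BoundedCovering X F B D) ∧
            effectiveDim X F ≤ ((C * (W : ℝ≥0) ^ 2 * (L : ℝ≥0) : ℝ≥0) : ℝ≥0∞)) ∧
        (60 ≤ W → 60 ≤ L →
          ((c * (W : ℝ≥0) ^ 2 * (L : ℝ≥0) : ℝ≥0) : ℝ≥0∞) ≤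
              effectiveDim (Set.Icc (0 : Fin d → ℝ) 1) (mlpClass d W L b) ∧
            effectiveDim (Set.Icc (0 : Fin d → ℝ) 1) (mlpClass d W L b) ≤
              ((C * (W : ℝ≥0) ^ 2 * (L : ℝ≥0) : ℝ≥0) : ℝ≥0∞)) := by
  obtain ⟨c, C, hc, hC, h⟩ := theorem7_general
  exact ⟨c, C, hc, hC, fun d W L b B hd hdW hL hb hB =>
    (h d W L b B hd hdW hL hb hB).imp_right fun h5 hW hL => h5 (by omega) (by omega)⟩
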